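/- For $c\in\mathbb R^5$, the cross centred at $c$ is the union of the closed axis-parallel unit cubes centred at $c$ and at $c\pm e_i$ ($1\le i\le 5$). A $Z$-tiling of $\mathbb R^5$ by crosses is a set $\mathcal T\subseteq\mathbb Z^5$ (whose elements are called codewords) such that the crosses centred at the points of $\mathcal T$ cover $\mathbb R^5$ and any two distinct ones have disjoint interiors. The $5$-neighbourhood of a codeword $W\in\mathcal T$ is $N_5(W)=\{V\in\mathcal T: V\neq W,\ \sum_{i=1}^5|V_i-W_i|\le 5\}$, and $N_5(W)-W=\{V-W: V\in N_5(W)\}$. A codeword $V$ is of type $[2^1,1^1]$ with respect to $W$ if $V-W$ has exactly two nonzero coordinates, one equal to $\pm2$ and the other equal to $\pm1$; let $B_{\mathcal T}(W)=\{V-W : V\in\mathcal T \text{ is of type } [2^1,1^1] \text{ with respect to } W\}$. Two subsets of $\mathbb Z^5$ are congruent if some linear distance-preserving bijection of (Euclidean) $\mathbb R^5$ maps one onto the other. For $V\in\mathbb Z^5$ let $\pm\langle V\rangle$ be the set of all cyclic shifts of the coordinates of $V$ and of $-V$. The canonical $5$-neighbourhood is the set $$\begin{aligned}\mathcal N={}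&\pm\langle(2,1,0,0,0)\rangle\cup\pm\langle(1,0,1,0,-1)\rangle\cup\pm\langle(3,0,0,-1,0)\rangle\cup\pm\langle(2,0,1,0,1)\rangle\\&\cup\pm\langle(2,0,0,1,-1)\rangle\cup\pm\langle(2,-1,-1,0,0)\rangle\cup\pm\langle(1,1,1,-1,0)\rangle\cup\pm\langle(4,0,-1,0,0)\rangle\\&\cup\pm\langle(3,0,2,0,0)\rangle\cup\pm\langle(3,0,0,1,1)\rangle\cup\pm\langle(3,-1,0,0,-1)\rangle\cup\pm\langle(2,-2,0,0,1)\rangle\\&\cup\pm\langle(2,0,-2,0,-1)\rangle\cup\pm\langle(2,-1,1,1,0)\rangle\cup\pm\langle(2,0,-1,-1,1)\rangle\cup\pm\langle(1,1,1,1,1)\rangle.\end{aligned}$$ Theorem. Let $\mathcal T$ be a $Z$-tiling of $\mathbb R^5$ by crosses. Then, for each codeword $W\in\mathcal T$, the set $N_5(W)-W$ is congruent to $\mathcal N$. Moreover, the $5$-neighbourhood of $W$ is uniquely determined by the codewords of type $[2^1,1^1]$ with respect to $W$: if $\mathcal T,\mathcal T'$ are $Z$-tilings of $\mathbb R^5$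 by crosses and $W\in\mathcal T$, $W'\in\mathcal T'$ satisfy $B_{\mathcal T}(W)=B_{\mathcal T'}(W')$, then $N_5(W)-W=N_5(W')-W'$, the neighbourhoods being taken in $\mathcal T$ and $\mathcal T'$ respectively. -/

import Mathlib

namespace CrossTiling

/-- The closed axis-parallel unit cube of `ℝⁿ` with centre `c`. -/
def unitCube {n : ℕ} (c : EuclideanSpace ℝ (Fin n)) : Set (EuclideanSpace ℝ (Fin n)) :=
  {x | ∀ i, |x i - c i| ≤ 1 / 2}

/-- The `n`-dimensional cross with centre `c`: the `2 * n + 1` unit cubes consisting of the central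
cube and its reflections in all its faces. -/
def cross {n : ℕ} (c : EuclideanSpace ℝ (Fin n)) : Set (EuclideanSpace ℝ (Fin n)) :=
  unitCube c ∪
    ⋃ i : Fin n,
      (unitCube (c + EuclideanSpace.single i 1) ∪ unitCube (c - EuclideanSpace.single i 1))

/-- The crosses whose set of centres is `C` tile `ℝⁿ`: they cover the space, and distinct ones
have disjoint interiors. -/
def IsCrossTiling {n : ℕ} (C : Set (EuclideanSpace ℝ (Fin n))) : Prop :=
  (⋃ c ∈ C, cross c) = Set.univ ∧
    C.Pairwise fun c d => Disjoint (interior (cross c)) (interior (cross d))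

/-- Words: the elements of `ℤⁿ`. -/
abbrev Word (n : ℕ) : Type := Fin n → ℤ

/-- A word regarded as a point of `ℝⁿ`. -/
def toPoint {n : ℕ} (v : Word n) : EuclideanSpace ℝ (Fin n) :=
  WithLp.toLp 2 fun i => (v i : ℝ)

/-- `T ⊆ ℤⁿ` is the set of centres (codewords) of a `Z`-tiling of `ℝⁿ` by crosses. -/
def IsZTiling {n : ℕ} (T : Set (Word n)) : Prop :=
  IsCrossTiling (toPoint '' T)

/-- The Manhattan distance of two words. -/
def manhattanDist {n : ℕ} (v w : Word n) : ℤ :=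
  ∑ i, |v i - w i|

/-- The `k`-neighbourhood of `W` in `T`, the word `W` itself not being counted. -/
def neighborhood {n : ℕ} (T : Set (Word n)) (k : ℤ) (W : Word n) : Set (Word n) :=
  {V | V ∈ T ∧ V ≠ W ∧ manhattanDist W V ≤ k}

/-- The set `{V - W : V ∈ A}`. -/
def relativeTo {n : ℕ} (A : Set (Word n)) (W : Word n) : Set (Word n) :=
  (fun V => V - W) '' A

/-- Two sets of words are congruent if a linear distance-preserving bijection of `ℝⁿ` maps
one onto the other. -/
def Congruent {n : ℕ} (A B : Set (Word n)) : Prop :=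
  ∃ f : EuclideanSpace ℝ (Fin n) ≃ₗᵢ[ℝ] EuclideanSpace ℝ (Fin n),
    f '' (toPoint '' A) = toPoint '' B

/-- `v` is of type `m`: the multiset of the absolute values of its nonzero coordinates is `m`. -/
def HasType {n : ℕ} (m : Multiset ℕ) (v : Word n) : Prop :=
  ((Finset.univ : Finset (Fin n)).val.map fun i => (v i).natAbs).filter (fun a => a ≠ 0) = m

/-- The codewords of `T` that are of type `m` with respect to `W`. -/
def codewordsOfType {n : ℕ} (T : Set (Word n)) (m : Multiset ℕ) (W : Word n) : Set (Word n) :=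
  {V | V ∈ T ∧ HasType m (V - W)}

/-- `± <V>`: all cyclic shifts of `V` and of `-V`. -/
def signedShifts (V : Word 5) : Set (Word 5) :=
  {U | ∃ k : Fin 5, U = (fun i => V (i + k)) ∨ U = fun i => -V (i + k)}

/-- The canonical `5`-neighbourhood. -/
def canonicalNeighborhood : Set (Word 5) :=
  signedShifts ![2, 1, 0, 0, 0] ∪
  signedShifts ![1, 0, 1, 0, -1] ∪
  signedShifts ![3, 0, 0, -1, 0] ∪
  signedShifts ![2, 0, 1, 0, 1] ∪
  signedShifts ![2, 0, 0, 1, -1] ∪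
  signedShifts ![2, -1, -1, 0, 0] ∪
  signedShifts ![1, 1, 1, -1, 0] ∪
  signedShifts ![4, 0, -1, 0, 0] ∪
  signedShifts ![3, 0, 2, 0, 0] ∪
  signedShifts ![3, 0, 0, 1, 1] ∪
  signedShifts ![3, -1, 0, 0, -1] ∪
  signedShifts ![2, -2, 0, 0, 1] ∪
  signedShifts ![2, 0, -2, 0, -1] ∪
  signedShifts ![2, -1, 1, 1, 0] ∪
  signedShifts ![2, 0, -1, -1, 1] ∪
  signedShifts ![1, 1, 1, 1, 1]

end CrossTiling

namespace CrossTiling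

/-! Every such tiling is a lattice tiling `∑ c i * v i = 0` modulo `11`, with the five coefficients
representing the five classes `{z, -z}` of nonzero residues. Both claims follow from this.

The cross has `11` cells. Write the tiling as `P * 1_T = 1`, where `P` is the sum of the
translations by the cells, and raise `P` to a prime power `q` modulo `q`. For `q > 11` the cross
dilated by `q` still tiles with `T`; for `q = 11` the set `T` is `11`-periodic (`card_dilate`). By
Dirichlet's theorem, the reduction of `T` modulo `11` tiles with every nonzero dilate of the cross.

Such a set is the graph of a function `F` of the other coordinates. Along each axis `F` is a
solution of the toroidal queens problem of side `11`, and all of these are affine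
(`toroidalQueens_affine`). Being affine with nonzero slope in each variable, `F` is affine.

A signed permutation carries the coefficients to `canonicalCoeff`, which gives the congruence. The
words of type `[2¹,1¹]` are the relations `2 * c i = ± c j`; since `2` generates the units modulo
`11`, they fix `c` up to a factor. -/

/-! ### Prime dilates of a tile. -/

/-- Translation action of the group algebra on functions. -/
noncomputable def translationRep (R G : Type*) [CommRing R] [AddCommGroup G] :
    AddMonoidAlgebra R G →ₐ[R] Module.End R (G → R) :=
  AddMonoidAlgebra.lift R (Module.End R (G → R)) G
    { toFun := fun g => LinearMap.funLeft R R fun x => x - g.toAdd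
      map_one' := by ext f x; simp [LinearMap.funLeft]
      map_mul' := fun g h => by
        refine LinearMap.ext fun f => funext fun x => ?_
        simp [LinearMap.funLeft, sub_sub] }

theorem translationRep_single {R G : Type*} [CommRing R] [AddCommGroup G] (g : G) (f : G → R)
    (x : G) : translationRep R G (AddMonoidAlgebra.single g 1) f x = f (x - g) := by
  simp [translationRep, LinearMap.funLeft]

/-- By Frobenius, `P ^ q` is the sum of the translations by `q • a s`, so applied to the indicator
of `T` it gives the count. The first factor `P` turns the indicator into `1`, and each of the other
`q - 1` multiplies a constant by the size of the tile. -/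
theorem card_dilate {G ι : Type*} [AddCommGroup G] [Fintype ι] {a : ι → G} {T : Set G}
    (h : ∀ x, ∃! s, x - a s ∈ T) (q : ℕ) [Fact q.Prime] (x : G)
    [DecidablePred fun s => x - q • a s ∈ T] :
    ((Finset.univ.filter fun s => x - q • a s ∈ T).card : ZMod q) =
      (Fintype.card ι : ZMod q) ^ (q - 1) := by
  classical
  let ρ := translationRep (ZMod q) G
  let P : AddMonoidAlgebra (ZMod q) G := ∑ s, AddMonoidAlgebra.single (a s) 1
  let f : G → ZMod q := T.indicator 1
  have hconst (c : ZMod q) : ρ P (fun _ => c) = fun _ => (Fintype.card ι : ZMod q) * c := by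
    ext y
    simp [P, ρ, LinearMap.sum_apply, Finset.sum_apply, translationRep_single]
  have hf : ρ P f = fun _ => 1 := by
    ext y
    obtain ⟨s, hs, hu⟩ := h y
    simp only [P, ρ, map_sum, LinearMap.sum_apply, Finset.sum_apply, translationRep_single]
    rw [Finset.sum_eq_single s]
    · simp [f, hs]
    · intro t _ ht
      have : y - a t ∉ T := fun hh => ht (hu t hh)
      simp [f, this]
    · simp
  have hpow (n : ℕ) : ρ (P ^ (n + 1)) f = fun _ => (Fintype.card ι : ZMod q) ^ n := by
    induction n with
    | zero => simp [hf]
    | succ n ih =>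
      rw [pow_succ', map_mul, Module.End.mul_apply, ih, hconst]
      ext; ring
  have : CharP (AddMonoidAlgebra (ZMod q) G) q :=
    charP_of_injective_algebraMap (FaithfulSMul.algebraMap_injective (ZMod q) _) q
  have hP : P ^ q = ∑ s, AddMonoidAlgebra.single (q • a s) 1 := by
    simp [P, sum_pow_char, AddMonoidAlgebra.single_pow]
  have hq : q - 1 + 1 = q := Nat.sub_add_cancel (Fact.out : q.Prime).one_le
  have key := congrFun (hpow (q - 1)) x
  rw [hq, hP] at key
  simp only [ρ, map_sum, LinearMap.sum_apply, Finset.sum_apply, translationRep_single] at key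
  rw [← key, Finset.card_filter]
  push_cast
  exact Finset.sum_congr rfl fun s _ => by simp [f, Set.indicator_apply]

/-- By Fermat the count is `1` modulo `q`, and it is below `q`. -/
theorem existsUnique_dilate {G ι : Type*} [AddCommGroup G] [Fintype ι] {a : ι → G} {T : Set G}
    (h : ∀ x, ∃! s, x - a s ∈ T) {q : ℕ} (hq : q.Prime) (hc : Fintype.card ι < q) (x : G) :
    ∃! s, x - q • a s ∈ T := by
  classical
  have := Fact.mk hq
  obtain ⟨s₀, -⟩ := h 0
  have hpos : 0 < Fintype.card ι := Fintype.card_pos_iff.2 ⟨s₀⟩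
  have h1 := card_dilate h q x
  have hne : (Fintype.card ι : ZMod q) ≠ 0 := fun h0 =>
    absurd (Nat.le_of_dvd hpos ((ZMod.natCast_eq_zero_iff _ _).1 h0)) (by omega)
  rw [ZMod.pow_card_sub_one_eq_one hne, ← Nat.cast_one, ZMod.natCast_eq_natCast_iff] at h1
  have hle := Finset.card_le_univ (Finset.univ.filter fun s => x - q • a s ∈ T)
  have h2 := Nat.ModEq.eq_of_lt_of_lt h1 (by omega) hq.one_lt
  obtain ⟨s, hs⟩ := Finset.card_eq_one.1 h2
  refine ⟨s, ?_, fun t ht => ?_⟩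
  · have : s ∈ Finset.univ.filter fun s => x - q • a s ∈ T := by simp [hs]
    simpa using this
  · have : t ∈ Finset.univ.filter fun s => x - q • a s ∈ T := by simpa using ht
    simpa [hs] using this

/-- With `q` the size of the tile, the count is divisible by `q`; it is positive because of `s₀`,
hence every `s` is counted. -/
theorem sub_card_smul_mem {G ι : Type*} [AddCommGroup G] [Fintype ι] {a : ι → G} {T : Set G}
    (h : ∀ x, ∃! s, x - a s ∈ T) (hp : (Fintype.card ι).Prime) {s₀ : ι} (h₀ : a s₀ = 0) {x : G}
    (hx : x ∈ T) (s : ι) : x - Fintype.card ι • a s ∈ T := by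
  classical
  have := Fact.mk hp
  have h1 := card_dilate h (Fintype.card ι) x
  rw [ZMod.natCast_self, zero_pow (Nat.sub_ne_zero_of_lt hp.one_lt),
    ZMod.natCast_eq_zero_iff] at h1
  have h2 : s₀ ∈ Finset.univ.filter fun s => x - Fintype.card ι • a s ∈ T := by simpa [h₀] using hx
  have h3 := Finset.eq_univ_of_card _
    (le_antisymm (Finset.card_le_univ _) (Nat.le_of_dvd (Finset.card_pos.2 ⟨_, h2⟩) h1))
  have h4 := Finset.mem_univ s
  rw [← h3] at h4
  simpa using h4

/-! ### Toroidal queens on the board of side `11`. -/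

/-- All extensions by one row of the partial solutions `L` of the toroidal queens problem on the
board of side `11`; the rows are listed from the last to the first. -/
def queensStep (L : List (List ℕ)) : List (List ℕ) :=
  L.flatMap fun l => ((List.range 11).filter fun b =>
    -- Indices start at `1`, so `p.2` is the distance from the new row to the row of `p`.
    (l.zipIdx 1).all fun p =>
      !(b.beq p.1) && !(((b + p.2) % 11).beq p.1) && !(b.beq ((p.1 + p.2) % 11))).map (· :: l)

/-- The placements of toroidal queens in the rows `0, …, n`, the first one in column `0`. -/
def queens : ℕ → List (List ℕ)
  | 0 => [[0]]
  | n + 1 => queensStep (queens n)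

/-- Exhaustive search. The lists begin with row `10`, so the entry of index `p.2` lies in row `10 -
p.2`. -/
theorem queens_linear : (queens 10).all (fun l => (List.range 11).any fun s =>
    (l.zipIdx 0).all fun p => p.1.beq (((10 - p.2) * s) % 11)) = true := by
  decide +kernel

/-- The columns `π n, …, π 0`. -/
def columns (π : ZMod 11 → ZMod 11) : ℕ → List ℕ
  | 0 => [(π (0 : ℕ)).val]
  | n + 1 => (π (n + 1 : ℕ)).val :: columns π n

theorem of_mem_zipIdx_columns {π : ZMod 11 → ZMod 11} {n k : ℕ} {p : ℕ × ℕ}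
    (hp : p ∈ (columns π n).zipIdx k) : ∃ m ≤ n, p.1 = (π (m : ℕ)).val ∧ p.2 + m = n + k := by
  induction n generalizing k with
  | zero =>
    simp only [columns, List.zipIdx_cons, List.zipIdx_nil, List.mem_singleton] at hp
    exact ⟨0, le_rfl, by simp [hp], by simp [hp]⟩
  | succ n ih =>
    rw [columns, List.zipIdx_cons, List.mem_cons] at hp
    rcases hp with rfl | hp
    · exact ⟨n + 1, le_rfl, rfl, by simp; omega⟩
    · obtain ⟨m, h1, h2, h3⟩ := ih hp
      exact ⟨m, by omega, h2, by omega⟩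

theorem mem_zipIdx_columns (π : ZMod 11 → ZMod 11) {m n : ℕ} (h : m ≤ n) (k : ℕ) :
    ((π (m : ℕ)).val, n - m + k) ∈ (columns π n).zipIdx k := by
  induction n generalizing k with
  | zero =>
    obtain rfl : m = 0 := by omega
    simp [columns]
  | succ n ih =>
    rw [columns, List.zipIdx_cons, List.mem_cons]
    rcases h.eq_or_lt with rfl | h
    · left; simp
    · right
      have := ih (by omega : m ≤ n) (k + 1)
      rwa [show n - m + (k + 1) = n + 1 - m + k by omega] at this

theorem columns_mem_queens {π : ZMod 11 → ZMod 11} (h0 : π 0 = 0) (h1 : Function.Injective π)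
    (h2 : Function.Injective fun x => π x + x) (h3 : Function.Injective fun x => π x - x) {n : ℕ}
    (hn : n ≤ 10) : columns π n ∈ queens n := by
  induction n with
  | zero => simp [columns, queens, h0]
  | succ n ih =>
    rw [queens, queensStep, List.mem_flatMap]
    refine ⟨_, ih (by omega), ?_⟩
    rw [columns, List.mem_map]
    refine ⟨_, ?_, rfl⟩
    rw [List.mem_filter, List.mem_range, List.all_eq_true]
    refine ⟨ZMod.val_lt _, fun p hp => ?_⟩
    obtain ⟨m, hm, hp1, hp2⟩ := of_mem_zipIdx_columns hp
    have hne : ((n + 1 : ℕ) : ZMod 11) ≠ (m : ℕ) := by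
      rw [Ne, ZMod.natCast_eq_natCast_iff]
      intro h
      have := Nat.ModEq.eq_of_lt_of_lt h (by omega) (by omega)
      omega
    have hd : (p.2 : ZMod 11) = (n + 1 : ℕ) - (m : ℕ) := by
      rw [eq_sub_iff_add_eq]
      exact_mod_cast congrArg (Nat.cast (R := ZMod 11)) hp2
    simp only [Bool.and_eq_true, Bool.not_eq_true', hp1]
    refine ⟨⟨?_, ?_⟩, ?_⟩ <;> refine Bool.eq_false_iff.2 fun h => hne ?_ <;>
      replace h := congrArg (Nat.cast (R := ZMod 11)) (Nat.eq_of_beq_eq_true h)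
    · exact h1 (by simpa using h)
    · refine h2 ?_
      simp only [ZMod.natCast_mod, Nat.cast_add (R := ZMod 11) (ZMod.val _), ZMod.natCast_val,
        ZMod.cast_id', id, hd] at h ⊢
      rw [← h]; ring
    · refine h3 ?_
      simp only [ZMod.natCast_mod, Nat.cast_add (R := ZMod 11) (ZMod.val _), ZMod.natCast_val,
        ZMod.cast_id', id, hd] at h ⊢
      rw [h]; ring

theorem toroidalQueens_linear {π : ZMod 11 → ZMod 11} (h0 : π 0 = 0) (h1 : Function.Injective π)
    (h2 : Function.Injective fun x => π x + x) (h3 : Function.Injective fun x => π x - x) :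
    ∃ m, ∀ x, π x = m * x := by
  have h := List.all_eq_true.1 queens_linear _ (columns_mem_queens h0 h1 h2 h3 le_rfl)
  obtain ⟨s, -, hs⟩ := List.any_eq_true.1 h
  refine ⟨s, fun x => ?_⟩
  have hx : x.val ≤ 10 := Nat.le_of_lt_succ (ZMod.val_lt x)
  have := List.all_eq_true.1 hs _ (mem_zipIdx_columns π hx 0)
  replace this := congrArg (Nat.cast (R := ZMod 11)) (Nat.eq_of_beq_eq_true this)
  simp only [add_zero, Nat.sub_sub_self hx, ZMod.natCast_mod, Nat.cast_mul, ZMod.natCast_val,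
    ZMod.cast_id', id] at this
  rw [this, mul_comm]

theorem toroidalQueens_affine {π : ZMod 11 → ZMod 11} (h1 : Function.Injective π)
    (h2 : Function.Injective fun x => π x + x) (h3 : Function.Injective fun x => π x - x) :
    ∃ m ≠ 0, ∀ x, π x = π 0 + m * x := by
  obtain ⟨m, hm⟩ := toroidalQueens_linear (π := fun x => π x - π 0) (sub_self _)
    (fun x y h => h1 (sub_left_injective h))
    (fun x y h => h2 (by
      have : π x - π 0 + x = π y - π 0 + y := h
      change π x + x = π y + y
      linear_combination this))
    (fun x y h => h3 (by
      have : π x - π 0 - x = π y - π 0 - y := h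
      change π x - x = π y - y
      linear_combination this))
  have hm' (x) : π x = π 0 + m * x := by rw [← hm]; ring
  refine ⟨m, ?_, hm'⟩
  rintro rfl
  exact absurd (h1 (a₁ := 1) (a₂ := 0) ((hm' 1).trans (by simp))) (by decide)

/-- A function that is affine with nonzero slope in each variable is affine. -/
theorem affine_of_separately_affine {ι K : Type*} [Fintype ι] [DecidableEq ι] [Field K]
    {F : (ι → K) → K} (h : ∀ x i, ∃ m ≠ 0, ∀ a, F (x + Pi.single i a) = F x + m * a) :
    ∃ c : ι → K, ∀ x, F x = F 0 + ∑ i, c i * x i := by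
  choose m hm0 hm using h
  -- The slope in direction `i` is an affine function of the `j`-th variable. Were it not constant,
  -- it would vanish somewhere, contrary to `hm0`.
  have hstep (x : ι → K) (i j : ι) (y : K) : m (x + Pi.single j y) i = m x i := by
    have key (y : K) :
        m (x + Pi.single j y) i = m x i + (m (x + Pi.single i 1) j - m x j) * y := by
      have h1 := hm (x + Pi.single j y) i 1
      rw [add_right_comm, hm, hm, hm] at h1
      linear_combination -h1
    by_cases hd : m (x + Pi.single i 1) j - m x j = 0
    · rw [key, hd]; ring
    · have := key (-(m x i) / (m (x + Pi.single i 1) j - m x j))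
      rw [mul_div_cancel₀ _ hd] at this
      exact absurd (this.trans (by ring)) (hm0 _ _)
  have hconst (i : ι) (x : ι → K) (s : Finset ι) : m (∑ j ∈ s, Pi.single j (x j)) i = m 0 i := by
    induction s using Finset.induction_on with
    | empty => simp
    | insert j s hj ih => rw [Finset.sum_insert hj, add_comm, hstep, ih]
  refine ⟨fun i => m 0 i, fun x => ?_⟩
  have hsum (s : Finset ι) : F (∑ j ∈ s, Pi.single j (x j)) = F 0 + ∑ j ∈ s, m 0 j * x j := by
    induction s using Finset.induction_on with
    | empty => simp
    | insert j s hj ih =>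
      rw [Finset.sum_insert hj, add_comm, hm, ih, hconst, Finset.sum_insert hj]; ring
  have := hsum Finset.univ
  rwa [Finset.univ_sum_single] at this

/-! ### Sets tiling with all dilates of the cross modulo `11`. -/

instance fact_prime_eleven : Fact (Nat.Prime 11) := ⟨by norm_num⟩

/-- The vectors `0` and `± e_i`. -/
def crossStep (R : Type*) [Ring R] : Option (Fin 5 × ℤˣ) → Fin 5 → R
  | none => 0
  | some (i, ε) => Pi.single i ((ε : ℤ) : R)

/-- For every nonzero scalar `k`, the translates by `S` of the dilate by `k` of the
cross tile `(ZMod 11)⁵`. -/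
def IsDilationTiling (S : Set (Fin 5 → ZMod 11)) : Prop :=
  ∀ k : ZMod 11, k ≠ 0 → ∀ x, ∃! s, x - k • crossStep (ZMod 11) s ∈ S

namespace IsDilationTiling

variable {S : Set (Fin 5 → ZMod 11)}

theorem eq_of_add_eq_add (hS : IsDilationTiling S) {k : ZMod 11} (hk : k ≠ 0)
    {u w : Fin 5 → ZMod 11} (hu : u ∈ S) (hw : w ∈ S) {s t : Option (Fin 5 × ℤˣ)}
    (h : u + k • crossStep _ s = w + k • crossStep _ t) : s = t :=
  (hS k hk (u + k • crossStep _ s)).unique (by simpa using hu) (by simpa [h] using hw)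

/-- At scale `a`, an arm of the cross at `w` would end at the centre of another. -/
theorem eq_zero_of_add_single_mem (hS : IsDilationTiling S) {w : Fin 5 → ZMod 11} (hw : w ∈ S)
    {i : Fin 5} {a : ZMod 11} (h : w + Pi.single i a ∈ S) : a = 0 := by
  by_contra ha
  have := hS.eq_of_add_eq_add ha hw h (s := some (i, 1)) (t := none)
    (by simp [crossStep, ← Pi.single_smul])
  simp at this

theorem eq_of_add_single_mem (hS : IsDilationTiling S) {w : Fin 5 → ZMod 11}
    {i : Fin 5} {a b : ZMod 11} (ha : w + Pi.single i a ∈ S) (hb : w + Pi.single i b ∈ S) :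
    a = b := by
  have := hS.eq_zero_of_add_single_mem ha (i := i) (a := b - a)
    (by rwa [add_assoc, ← Pi.single_add, add_sub_cancel])
  exact (sub_eq_zero.1 this).symm

theorem eq_zero_of_add_single_add_single_mem (hS : IsDilationTiling S) {w : Fin 5 → ZMod 11}
    (hw : w ∈ S) {i j : Fin 5} (hij : i ≠ j) {a : ZMod 11} (ε : ℤˣ)
    (h : w + Pi.single i a + Pi.single j (a * (ε : ℤ)) ∈ S) : a = 0 := by
  by_contra ha
  have := hS.eq_of_add_eq_add ha hw h (s := some (i, 1)) (t := some (j, -ε))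
    (by simp [crossStep, ← Pi.single_smul, add_assoc, ← Pi.single_add])
  simp [hij] at this

/-- For each scale, taken up to sign and other than `± a`, the point `w + a e_i` lies on an arm of
one dilated cross, whose direction is not `i`. Different scales use different directions, since an
axis-parallel line holds at most one point of `S`. The four scales thus exhaust the four directions
other than `i`. -/
theorem exists_add_single_add_single_mem (hS : IsDilationTiling S) {w : Fin 5 → ZMod 11}
    (hw : w ∈ S) {i j : Fin 5} (hij : i ≠ j) (a : ZMod 11) :
    ∃ b, w + Pi.single i a + Pi.single j b ∈ S := by
  rcases eq_or_ne a 0 with rfl | ha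
  · exact ⟨0, by simpa using hw⟩
  -- The scales `1, …, 5` represent the nonzero residues up to sign.
  let K : Finset (Fin 5) := {k | ((k : ℕ) + 1 : ZMod 11) ≠ a ∧ ((k : ℕ) + 1 : ZMod 11) ≠ -a}
  have hK : K.card = 4 := by revert a; decide
  have H : ∀ k : Fin 5, ∃ p : Fin 5 × ℤˣ, k ∈ K → p.1 ≠ i ∧
      w + Pi.single i a + Pi.single p.1 (-(((k : ℕ) + 1 : ZMod 11) * ((p.2 : ℤ) : ZMod 11))) ∈ S := by
    intro k
    by_cases hk : k ∈ K
    · simp only [K, Finset.mem_filter, Finset.mem_univ, true_and] at hk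
      obtain ⟨s, hs, -⟩ := hS ((k : ℕ) + 1) (by clear hk; revert k; decide) (w + Pi.single i a)
      rcases s with _ | ⟨l, ε⟩
      · exact absurd (hS.eq_zero_of_add_single_mem hw (by simpa [crossStep] using hs)) ha
      · have hs' : w + Pi.single i a +
            Pi.single l (-(((k : ℕ) + 1 : ZMod 11) * ((ε : ℤ) : ZMod 11))) ∈ S := by
          rw [Pi.single_neg, ← sub_eq_add_neg]
          simpa [crossStep, ← Pi.single_smul] using hs
        refine ⟨(l, ε), fun _ => ⟨?_, hs'⟩⟩
        rintro rfl
        rw [add_assoc, ← Pi.single_add] at hs'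
        have h0 := hS.eq_zero_of_add_single_mem hw hs'
        rcases Int.units_eq_one_or ε with rfl | rfl
        · exact hk.1 (by simp at h0; linear_combination -h0)
        · exact hk.2 (by simp at h0; linear_combination h0)
    · exact ⟨(0, 1), fun h => absurd h hk⟩
  choose p hp using H
  have hinj : Set.InjOn (fun k => (p k).1) K := by
    intro k hk l hl hkl
    have h1 := (hp k hk).2
    have h2 := (hp l hl).2
    rw [← show (p k).1 = (p l).1 from hkl] at h2
    have := hS.eq_of_add_single_mem h1 h2
    revert this
    generalize (p k).2 = ε
    generalize (p l).2 = δ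
    clear * -
    revert k l ε δ
    decide
  have hsurj : Set.SurjOn (fun k => (p k).1) K (Finset.univ.erase i : Finset (Fin 5)) :=
    Finset.surjOn_of_injOn_of_card_le _ (fun k hk => by simpa using (hp k hk).1) hinj
      (by simp [hK])
  obtain ⟨k, hk, rfl⟩ := hsurj (a := j) (by simpa using hij.symm)
  exact ⟨_, (hp k hk).2⟩

/-- Move from `w` to `x` one coordinate at a time, correcting each move along direction `j`. -/
theorem exists_add_single_mem (hS : IsDilationTiling S) {w : Fin 5 → ZMod 11} (hw : w ∈ S)
    (j : Fin 5) (x : Fin 5 → ZMod 11) : ∃ b, x + Pi.single j b ∈ S := by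
  have key (s : Finset (Fin 5)) :
      ∃ b, w + ∑ i ∈ s, Pi.single i (x i - w i) + Pi.single j b ∈ S := by
    induction s using Finset.induction_on with
    | empty => exact ⟨0, by simpa using hw⟩
    | insert i s hi ih =>
      obtain ⟨b, hb⟩ := ih
      rw [Finset.sum_insert hi]
      rcases eq_or_ne i j with rfl | hij
      · refine ⟨b - (x i - w i), ?_⟩
        convert hb using 1
        generalize x i - w i = d
        rw [Pi.single_sub]; abel
      · obtain ⟨b', hb'⟩ := hS.exists_add_single_add_single_mem hb hij (x i - w i)
        refine ⟨b + b', ?_⟩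
        convert hb' using 1
        rw [Pi.single_add]; abel
  have h := key Finset.univ
  have hx : ∑ i, Pi.single i (x i - w i) = x - w := Finset.univ_sum_single (x - w)
  rwa [hx, add_sub_cancel] at h

/-- A set of centres of all dilated crosses is a hyperplane. -/
theorem exists_mem_iff (hS : IsDilationTiling S) (h0 : 0 ∈ S) :
    ∃ c : Fin 5 → ZMod 11, (∀ i, c i ≠ 0) ∧ (∀ i j, i ≠ j → c i ≠ c j ∧ c i ≠ -c j) ∧
      ∀ x, x ∈ S ↔ ∑ i, c i * x i = 0 := by
  choose F hF using hS.exists_add_single_mem h0 0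
  have hFu {x : Fin 5 → ZMod 11} {b : ZMod 11} (h : x + Pi.single 0 b ∈ S) : F x = b :=
    hS.eq_of_add_single_mem (hF x) h
  have hF0 : F 0 = 0 := hFu (by simpa using h0)
  obtain ⟨c, hc⟩ := affine_of_separately_affine (F := F) fun x i => by
    rcases eq_or_ne i 0 with rfl | hi
    · refine ⟨-1, by decide, fun a => hFu ?_⟩
      convert hF x using 1
      rw [add_assoc, ← Pi.single_add]
      congr 2; ring
    -- No two points of `S` share a diagonal, so `F` along direction `i` places toroidal queens.
    · have hdiag (ε : ℤˣ) (a b : ZMod 11)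
          (h : F (x + Pi.single i b) - F (x + Pi.single i a) = (b - a) * (ε : ℤ)) : a = b := by
        have := hS.eq_zero_of_add_single_add_single_mem (hF (x + Pi.single i a)) hi
          (a := b - a) ε (by
            convert hF (x + Pi.single i b) using 1
            rw [← h, Pi.single_sub, Pi.single_sub]; abel)
        exact (sub_eq_zero.1 this).symm
      obtain ⟨m, hm, h⟩ := toroidalQueens_affine (π := fun a => F (x + Pi.single i a))
        (fun a b h => by
          have h1 := hF (x + Pi.single i a)
          have h2 := hF (x + Pi.single i b)
          rw [← show F (x + Pi.single i a) = F (x + Pi.single i b) from h] at h2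
          rw [add_right_comm] at h1 h2
          exact hS.eq_of_add_single_mem h1 h2)
        (fun a b h => hdiag (-1) a b (by
          have : F (x + Pi.single i a) + a = F (x + Pi.single i b) + b := h
          simp; linear_combination -this))
        (fun a b h => hdiag 1 a b (by
          have : F (x + Pi.single i a) - a = F (x + Pi.single i b) - b := h
          simp; linear_combination -this))
      exact ⟨m, hm, fun a => by simpa using h a⟩
  have hmem (x) : x ∈ S ↔ ∑ i, c i * x i = 0 := by
    have hx : F x = ∑ i, c i * x i := by rw [hc, hF0, zero_add]
    rw [← hx]
    exact ⟨fun h => hFu (by simpa using h), fun h => by simpa [h] using hF x⟩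
  have hsum (i : Fin 5) (a : ZMod 11) :
      ∑ l, c l * (Pi.single i a : Fin 5 → ZMod 11) l = c i * a := by
    simp [Pi.single_apply]
  refine ⟨c, fun i hi => ?_, fun i j hij => ⟨fun h => ?_, fun h => ?_⟩, hmem⟩
  · refine absurd (hS.eq_zero_of_add_single_mem h0 (i := i) (a := 1) ?_) (by decide)
    rw [zero_add, hmem, hsum, hi, zero_mul]
  · refine absurd (hS.eq_zero_of_add_single_add_single_mem h0 hij (a := 1) (-1) ?_) (by decide)
    rw [zero_add, hmem]
    simp only [Pi.add_apply, mul_add, Finset.sum_add_distrib, hsum, h]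
    simp
  · refine absurd (hS.eq_zero_of_add_single_add_single_mem h0 hij (a := 1) 1 ?_) (by decide)
    rw [zero_add, hmem]
    simp only [Pi.add_apply, mul_add, Finset.sum_add_distrib, hsum, h]
    simp

end IsDilationTiling

/-! ### From crosses in real space to tilings of the integer lattice. -/

theorem mem_cross_iff {n : ℕ} {c x : EuclideanSpace ℝ (Fin n)} :
    x ∈ cross c ↔ x ∈ unitCube c ∨
      ∃ i, ∃ ε : ℤˣ, x ∈ unitCube (c + EuclideanSpace.single i ((ε : ℤ) : ℝ)) := by
  simp only [cross, Set.mem_union, Set.mem_iUnion]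
  refine or_congr Iff.rfl (exists_congr fun i => ⟨?_, ?_⟩)
  · rintro (h | h)
    · exact ⟨1, by simpa using h⟩
    · refine ⟨-1, ?_⟩
      convert h using 2
      ext j; simp [sub_eq_add_neg]; split_ifs <;> simp
  · rintro ⟨ε, h⟩
    rcases Int.units_eq_one_or ε with rfl | rfl
    · left; simpa using h
    · right
      convert h using 2
      ext j; simp [sub_eq_add_neg]; split_ifs <;> simp

theorem toPoint_mem_unitCube {n : ℕ} {x v : Word n} : toPoint x ∈ unitCube (toPoint v) ↔ x = v := by
  constructor
  · intro h
    ext i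
    have hi := h i
    simp only [toPoint] at hi
    have h1 : |x i - v i| < 1 := by
      have : (|x i - v i| : ℝ) < 1 := lt_of_le_of_lt hi (by norm_num)
      exact_mod_cast this
    exact sub_eq_zero.1 (Int.abs_lt_one_iff.1 h1)
  · rintro rfl i
    simp

theorem self_mem_interior_unitCube {n : ℕ} (c : EuclideanSpace ℝ (Fin n)) :
    c ∈ interior (unitCube c) := by
  refine mem_interior.2 ⟨{x | ∀ i, |x i - c i| < 1 / 2}, fun x hx i => (hx i).le, ?_, by simp⟩
  simp only [Set.ofPred_forall]
  exact isOpen_iInter_of_finite fun i => isOpen_lt (by fun_prop) continuous_const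

theorem unitCube_subset_cross (v : Word 5) (s : Option (Fin 5 × ℤˣ)) :
    unitCube (toPoint (v + crossStep ℤ s)) ⊆ cross (toPoint v) := by
  intro x hx
  rw [mem_cross_iff]
  rcases s with _ | ⟨i, ε⟩
  · left; simpa [crossStep] using hx
  · right
    refine ⟨i, ε, ?_⟩
    convert hx using 2
    ext j; simp [toPoint, crossStep, Pi.single_apply]

theorem toPoint_mem_cross {x v : Word 5} :
    toPoint x ∈ cross (toPoint v) ↔ ∃ s, x = v + crossStep ℤ s := by
  constructor
  · rw [mem_cross_iff]
    rintro (h | ⟨i, ε, h⟩)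
    · exact ⟨none, by simpa [crossStep] using toPoint_mem_unitCube.1 h⟩
    · refine ⟨some (i, ε), toPoint_mem_unitCube.1 ?_⟩
      convert h using 2
      ext j; simp [toPoint, crossStep, Pi.single_apply]
  · rintro ⟨s, rfl⟩
    exact unitCube_subset_cross v s (toPoint_mem_unitCube.2 rfl)

theorem crossStep_injective : Function.Injective (crossStep ℤ) := by
  unfold Function.Injective
  decide

/-- An integer point of a cross is the centre of one of its cubes, hence interior; so it cannot lie
in two crosses. -/
theorem IsZTiling.existsUnique {T : Set (Word 5)} (hT : IsZTiling T) (x : Word 5) :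
    ∃! s, x - crossStep ℤ s ∈ T := by
  have hx : toPoint x ∈ ⋃ c ∈ toPoint '' T, cross c := by rw [hT.1]; trivial
  simp only [Set.mem_iUnion, Set.exists_mem_image, exists_prop] at hx
  obtain ⟨v, hv, hxv⟩ := hx
  obtain ⟨s, rfl⟩ := toPoint_mem_cross.1 hxv
  refine ⟨s, by simpa using hv, fun t ht => ?_⟩
  have hinj : Function.Injective (toPoint (n := 5)) := fun a b h => by
    ext i
    have := congrArg (fun p : EuclideanSpace ℝ (Fin 5) => p i) h
    simpa [toPoint] using this
  have hint (u : Word 5) (r) (h : v + crossStep ℤ s = u + crossStep ℤ r) :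
      toPoint (v + crossStep ℤ s) ∈ interior (cross (toPoint u)) := by
    rw [h]
    exact interior_mono (unitCube_subset_cross u r) (self_mem_interior_unitCube _)
  have heq : v + crossStep ℤ s - crossStep ℤ t = v := by
    by_contra hne
    exact Set.disjoint_left.1 (hT.2 (Set.mem_image_of_mem _ ht) (Set.mem_image_of_mem _ hv)
      (hinj.ne hne)) (hint _ t (by simp)) (hint v s rfl)
  exact crossStep_injective (by linear_combination (exp := 1) -heq)

/-! ### Reduction modulo `11`. -/

/-- The reduction modulo `11` of a word. -/
def reduceWord : Word 5 →+ (Fin 5 → ZMod 11) :=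
  (Int.castAddHom (ZMod 11)).compLeft (Fin 5)

theorem reduceWord_apply (x : Word 5) (i : Fin 5) : reduceWord x i = x i := rfl

theorem reduceWord_crossStep (s : Option (Fin 5 × ℤˣ)) :
    reduceWord (crossStep ℤ s) = crossStep (ZMod 11) s := by
  ext j
  rcases s with _ | ⟨i, ε⟩
  · simp [crossStep]
  · simp [reduceWord_apply, crossStep, Pi.single_apply, apply_ite (Int.cast (R := ZMod 11))]

theorem reduceWord_surjective : Function.Surjective reduceWord := fun x =>
  ⟨fun i => (x i).val, by ext i; simp [reduceWord_apply]⟩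

/-- A cross tiling is periodic modulo `11`. -/
theorem add_smul_mem_of_existsUnique {T : Set (Word 5)}
    (hT : ∀ x, ∃! s, x - crossStep ℤ s ∈ T) {x : Word 5} (hx : x ∈ T) (z : Word 5) :
    x + (11 : ℤ) • z ∈ T := by
  have hcard : Fintype.card (Option (Fin 5 × ℤˣ)) = 11 := by decide
  have hstep {x : Word 5} (hx : x ∈ T) (i : Fin 5) (ε : ℤˣ) :
      x + Pi.single i (11 * (ε : ℤ)) ∈ T := by
    have := sub_card_smul_mem hT (by rw [hcard]; norm_num) (s₀ := none) rfl hx (some (i, -ε))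
    rw [hcard] at this
    convert this using 1
    ext j
    simp [crossStep, Pi.single_apply]
    split_ifs <;> simp
  have hsingle {x : Word 5} (hx : x ∈ T) (i : Fin 5) (a : ℤ) : x + Pi.single i (11 * a) ∈ T := by
    induction a using Int.induction_on with
    | zero => simpa using hx
    | succ n ih =>
      convert hstep ih i 1 using 1
      rw [add_assoc, ← Pi.single_add]; congr 2
    | pred n ih =>
      convert hstep ih i (-1) using 1
      rw [add_assoc, ← Pi.single_add]; congr 2; simp; ring
  have hsum (s : Finset (Fin 5)) : x + ∑ i ∈ s, Pi.single i (11 * z i) ∈ T := by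
    induction s using Finset.induction_on with
    | empty => simpa using hx
    | insert i s hi ih =>
      rw [Finset.sum_insert hi, add_comm (Pi.single _ _), ← add_assoc]
      exact hsingle ih i _
  have h := hsum Finset.univ
  have hz : ∑ i, Pi.single i (11 * z i) = (11 : ℤ) • z := Finset.univ_sum_single ((11 : ℤ) • z)
  rwa [hz] at h

theorem reduceWord_mem_image_iff {T : Set (Word 5)} (hT : ∀ x, ∃! s, x - crossStep ℤ s ∈ T)
    (x : Word 5) : reduceWord x ∈ reduceWord '' T ↔ x ∈ T := by
  refine ⟨?_, Set.mem_image_of_mem _⟩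
  rintro ⟨y, hy, hyx⟩
  have h (i) : ∃ z, x i - y i = 11 * z := by
    have := congrFun hyx i
    rw [reduceWord_apply, reduceWord_apply, ZMod.intCast_eq_intCast_iff_dvd_sub] at this
    exact this
  choose z hz using h
  convert add_smul_mem_of_existsUnique hT hy z using 1
  ext i
  simp [← hz]

theorem isDilationTiling_image {T : Set (Word 5)} (hT : ∀ x, ∃! s, x - crossStep ℤ s ∈ T) :
    IsDilationTiling (reduceWord '' T) := by
  intro k hk x
  obtain ⟨x, rfl⟩ := reduceWord_surjective x
  -- Dirichlet's theorem supplies a prime `q > 11` in the residue class of `k`.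
  obtain ⟨q, hq, hqp, hqk⟩ := Nat.forall_exists_prime_gt_and_eq_mod (q := 11) hk.isUnit 11
  have := existsUnique_dilate hT hqp (by simpa using hq) x
  refine (existsUnique_congr fun s => ?_).1 this
  rw [← reduceWord_mem_image_iff hT, map_sub, map_nsmul, reduceWord_crossStep, ← hqk,
    Nat.cast_smul_eq_nsmul]

/-- Every cross tiling of `ℝ⁵` with integer centres is a lattice tiling. -/
theorem IsZTiling.exists_mem_iff {T : Set (Word 5)} (hT : IsZTiling T) {W : Word 5} (hW : W ∈ T) :
    ∃ c : Fin 5 → ZMod 11, (∀ i, c i ≠ 0) ∧ (∀ i j, i ≠ j → c i ≠ c j ∧ c i ≠ -c j) ∧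
      ∀ v, v + W ∈ T ↔ ∑ i, c i * v i = 0 := by
  have h : ∀ x, ∃! s, x - crossStep ℤ s ∈ {v | v + W ∈ T} := fun x => by
    refine (existsUnique_congr fun s => ?_).1 (hT.existsUnique (x + W))
    rw [Set.mem_ofPred_eq, sub_add_eq_add_sub]
  obtain ⟨c, h0, hne, hc⟩ := (isDilationTiling_image h).exists_mem_iff
    ⟨0, by simpa using hW, map_zero _⟩
  exact ⟨c, h0, hne, fun v => (reduceWord_mem_image_iff h v).symm.trans (hc _)⟩

/-! ### The canonical neighbourhood and congruence with it. -/

/-- The coefficients of the canonical tiling. -/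
def canonicalCoeff : Fin 5 → ℤ := ![1, 9, 4, 3, 5]

instance decidableMemSignedShifts (U V : Word 5) : Decidable (U ∈ signedShifts V) :=
  inferInstanceAs (Decidable (∃ _, _))

instance decidableMemCanonicalNeighborhood (U : Word 5) :
    Decidable (U ∈ canonicalNeighborhood) := by
  unfold canonicalNeighborhood
  simp only [Set.mem_union]
  infer_instance

/-- The integers of absolute value at most `5`. -/
def smallInts : List ℤ := (List.range 11).map fun n : ℕ => (n : ℤ) - 5

theorem mem_smallInts {a : ℤ} (h : |a| ≤ 5) : a ∈ smallInts := by
  rw [abs_le] at h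
  rw [smallInts, List.mem_map]
  refine ⟨(a + 5).toNat, ?_, ?_⟩
  · rw [List.mem_range]; omega
  · omega

theorem canonicalNeighborhood_search : (smallInts.all fun a => smallInts.all fun b =>
    decide (5 < |a| + |b|) || smallInts.all fun c =>
    decide (5 < |a| + |b| + |c|) || smallInts.all fun d =>
    decide (5 < |a| + |b| + |c| + |d|) || smallInts.all fun e =>
    decide (5 < |a| + |b| + |c| + |d| + |e|) ||
    (a + 9 * b + 4 * c + 3 * d + 5 * e) % 11 != 0 ||
    decide (![a, b, c, d, e] = 0) || decide (![a, b, c, d, e] ∈ canonicalNeighborhood)) = true := by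
  decide +kernel

theorem signedShifts_subset {V v : Word 5} {p : Word 5 → Prop} (hv : v ∈ signedShifts V)
    (h : ∀ k : Fin 5, p (fun i => V (i + k)) ∧ p fun i => -V (i + k)) : p v := by
  obtain ⟨k, rfl | rfl⟩ := hv
  exacts [(h k).1, (h k).2]

/-- One direction checks the listed words, the other searches the ball of radius `5`. -/
theorem mem_canonicalNeighborhood_iff (v : Word 5) : v ∈ canonicalNeighborhood ↔
    v ≠ 0 ∧ ∑ i, |v i| ≤ 5 ∧ (∑ i, canonicalCoeff i * v i) % 11 = 0 := by
  constructor
  · intro h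
    simp only [canonicalNeighborhood, Set.mem_union, or_assoc] at h
    rcases h with h | h | h | h | h | h | h | h | h | h | h | h | h | h | h | h <;>
      exact signedShifts_subset (p := fun v => v ≠ 0 ∧ ∑ i, |v i| ≤ 5 ∧
        (∑ i, canonicalCoeff i * v i) % 11 = 0) h (by decide +kernel)
  · rintro ⟨h0, h5, h11⟩
    have hm (i) : v i ∈ smallInts :=
      mem_smallInts ((Finset.single_le_sum (fun j _ => abs_nonneg (v j)) (Finset.mem_univ i)).trans
        h5)
    have hv : ![v 0, v 1, v 2, v 3, v 4] = v := by
      ext i; fin_cases i <;> rfl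
    simp only [Fin.sum_univ_five] at h5 h11
    simp only [canonicalCoeff, Matrix.cons_val, one_mul] at h11
    have := canonicalNeighborhood_search
    simp only [List.all_eq_true, Bool.or_eq_true, decide_eq_true_eq, bne_iff_ne] at this
    have hn0 := abs_nonneg (v 2)
    have hn1 := abs_nonneg (v 3)
    have hn2 := abs_nonneg (v 4)
    have := (((this _ (hm 0) _ (hm 1)).resolve_left (by linarith) _ (hm 2)).resolve_left
      (by linarith) _ (hm 3)).resolve_left (by linarith) _ (hm 4)
    rw [hv] at this
    rcases this with ((h | h) | h) | h
    · exact absurd h (by linarith)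
    · exact absurd h11 h
    · exact absurd h h0
    · exact h

theorem mem_canonicalNeighborhood_iff_cast (v : Word 5) : v ∈ canonicalNeighborhood ↔
    v ≠ 0 ∧ ∑ i, |v i| ≤ 5 ∧ ∑ i, (canonicalCoeff i : ZMod 11) * v i = 0 := by
  rw [mem_canonicalNeighborhood_iff, ← Int.dvd_iff_emod_eq_zero]
  refine and_congr_right fun _ => and_congr_right fun _ => ?_
  have := ZMod.intCast_zmod_eq_zero_iff_dvd (∑ i, canonicalCoeff i * v i) 11
  rw [← Nat.cast_ofNat (R := ℤ) (n := 11), ← this]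
  push_cast
  rfl

theorem mem_relativeTo_neighborhood {n : ℕ} {T : Set (Word n)} {k : ℤ} {W v : Word n} :
    v ∈ relativeTo (neighborhood T k W) W ↔ v + W ∈ T ∧ v ≠ 0 ∧ ∑ i, |v i| ≤ k := by
  have : v ∈ relativeTo (neighborhood T k W) W ↔ v + W ∈ neighborhood T k W :=
    ⟨by rintro ⟨V, hV, rfl⟩; simpa using hV, fun h => ⟨_, h, by simp⟩⟩
  rw [this]
  change v + W ∈ T ∧ v + W ≠ W ∧ ∑ i, |W i - (v + W) i| ≤ k ↔ _
  simp

theorem mem_relativeTo_codewordsOfType {n : ℕ} {T : Set (Word n)} {m : Multiset ℕ}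
    {W v : Word n} : v ∈ relativeTo (codewordsOfType T m W) W ↔ v + W ∈ T ∧ HasType m v := by
  have : v ∈ relativeTo (codewordsOfType T m W) W ↔ v + W ∈ codewordsOfType T m W :=
    ⟨by rintro ⟨V, hV, rfl⟩; simpa using hV, fun h => ⟨_, h, by simp⟩⟩
  rw [this]
  change v + W ∈ T ∧ HasType m (v + W - W) ↔ _
  rw [add_sub_cancel_right]

/-- The linear isometry permuting the coordinates and changing some of their signs. -/
noncomputable def signedPerm {n : ℕ} (σ : Equiv.Perm (Fin n)) (ε : Fin n → ℤˣ) :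
    EuclideanSpace ℝ (Fin n) ≃ₗᵢ[ℝ] EuclideanSpace ℝ (Fin n) :=
  (LinearIsometryEquiv.piLpCongrLeft 2 ℝ ℝ σ.symm).trans
    (LinearIsometryEquiv.piLpCongrRight 2 fun i =>
      if ε i = 1 then LinearIsometryEquiv.refl ℝ ℝ else LinearIsometryEquiv.neg ℝ)

theorem signedPerm_toPoint {n : ℕ} (σ : Equiv.Perm (Fin n)) (ε : Fin n → ℤˣ) (v : Word n) :
    signedPerm σ ε (toPoint v) = toPoint fun i => (ε i : ℤ) * v (σ i) := by
  ext i
  rcases Int.units_eq_one_or (ε i) with h | h <;>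
    simp [signedPerm, toPoint, h, LinearIsometryEquiv.piLpCongrLeft_apply,
      Equiv.piCongrLeft'_apply]

theorem congruent_canonicalNeighborhood {A : Set (Word 5)} {c : Fin 5 → ZMod 11}
    (h0 : ∀ i, c i ≠ 0) (hne : ∀ i j, i ≠ j → c i ≠ c j ∧ c i ≠ -c j)
    (hA : ∀ v, v ∈ A ↔ v ≠ 0 ∧ ∑ i, |v i| ≤ 5 ∧ ∑ i, c i * v i = 0) :
    Congruent A canonicalNeighborhood := by
  -- The canonical coefficients represent all five classes `{z, -z}`, so matching classes gives the
  -- signed permutation.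
  have hcls : ∀ z : ZMod 11, z ≠ 0 → ∃ i, ∃ ε : ℤˣ,
      (canonicalCoeff i : ZMod 11) = ((ε : ℤ) : ZMod 11) * z := by decide
  choose τ ε hτ using fun i => hcls (c i) (h0 i)
  have hinj : Function.Injective τ := by
    intro i j hij
    by_contra h
    have h1 := hτ i
    rw [hij, hτ j] at h1
    rcases Int.units_eq_one_or (ε i) with hi | hi <;>
      rcases Int.units_eq_one_or (ε j) with hj | hj <;>
      simp only [hi, hj, Units.val_one, Units.val_neg, Int.cast_one, Int.cast_neg, one_mul,
        neg_mul, neg_inj] at h1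
    · exact (hne i j h).1 h1.symm
    · exact (hne i j h).2 h1.symm
    · exact (hne i j h).2 (by rw [h1, neg_neg])
    · exact (hne i j h).1 h1.symm
  let σ : Equiv.Perm (Fin 5) := (Equiv.ofBijective τ (Finite.injective_iff_bijective.1 hinj)).symm
  have hσ (i) : (canonicalCoeff i : ZMod 11) = ((ε (σ i) : ℤ) : ZMod 11) * c (σ i) := by
    rw [← hτ]
    congr
    exact ((Equiv.ofBijective τ _).apply_symm_apply i).symm
  let g (v : Word 5) : Word 5 := fun i => (ε (σ i) : ℤ) * v (σ i)
  have hsq (i) : ((ε i : ℤ) * (ε i : ℤ)) = 1 := by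
    rcases Int.units_eq_one_or (ε i) with h | h <;> simp [h]
  have hgA (v) : g v ∈ canonicalNeighborhood ↔ v ∈ A := by
    rw [hA, mem_canonicalNeighborhood_iff_cast]
    refine and_congr (not_congr ?_) (and_congr ?_ ?_)
    · refine ⟨fun h => funext fun i => ?_, fun h => by ext; simp [g, h]⟩
      have := congrFun h (σ.symm i)
      simpa [g] using this
    · have : ∑ i, |g v i| = ∑ i, |v i| := by
        rw [← Equiv.sum_comp σ fun i => |v i|]
        refine Finset.sum_congr rfl fun i _ => ?_
        rcases Int.units_eq_one_or (ε (σ i)) with h | h <;> simp [g, h]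
      rw [this]
    · have : ∑ i, (canonicalCoeff i : ZMod 11) * (g v i : ℤ) = ∑ i, c i * v i := by
        rw [← Equiv.sum_comp σ fun i => c i * (v i : ZMod 11)]
        refine Finset.sum_congr rfl fun i _ => ?_
        have := congrArg (Int.cast (R := ZMod 11)) (hsq (σ i))
        push_cast at this
        rw [hσ]
        simp only [g]
        push_cast
        linear_combination c (σ i) * v (σ i) * this
      rw [this]
  refine ⟨signedPerm σ fun i => ε (σ i), ?_⟩
  ext p
  simp only [Set.mem_image, exists_exists_and_eq_and, signedPerm_toPoint]
  constructor
  · rintro ⟨v, hv, rfl⟩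
    exact ⟨g v, (hgA v).2 hv, rfl⟩
  · rintro ⟨u, hu, rfl⟩
    have hgu : g (fun i => (ε i : ℤ) * u (σ.symm i)) = u := by
      ext i
      simp [g, ← mul_assoc, hsq]
    exact ⟨fun i => (ε i : ℤ) * u (σ.symm i), (hgA _).1 (by rwa [hgu]), congrArg toPoint hgu⟩

/-! ### Uniqueness from the words of type `[2¹,1¹]`. -/

theorem hasType_two_one : ∀ i j : Fin 5, i ≠ j → ∀ ε : ℤˣ,
    HasType {2, 1} (Pi.single i 2 + Pi.single j (ε : ℤ) : Word 5) := by
  unfold HasType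
  decide +kernel

/-- The relations of type `[2¹,1¹]` determine the coefficients up to a common factor. -/
theorem exists_eq_mul_of_relations {c c' : Fin 5 → ZMod 11} (h0 : ∀ i, c i ≠ 0)
    (h0' : ∀ i, c' i ≠ 0) (hne : ∀ i j, i ≠ j → c i ≠ c j ∧ c i ≠ -c j)
    (h : ∀ i j, i ≠ j → ∀ ε : ℤˣ, c i * 2 + c j * (ε : ℤ) = 0 → c' i * 2 + c' j * (ε : ℤ) = 0) :
    ∃ r ≠ 0, ∀ i, c' i = r * c i := by
  refine ⟨c' 0 / c 0, div_ne_zero (h0' 0) (h0 0), ?_⟩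
  have hcls (z : ZMod 11) (hz : z ≠ 0) : ∃ i, z = c i ∨ z = -c i := by
    have hcl : ∀ z : ZMod 11, z ≠ 0 → ∃ i : Fin 5, z = ((i : ℕ) : ZMod 11) + 1 ∨
        z = -(((i : ℕ) : ZMod 11) + 1) := by decide
    choose! τ hτ using hcl
    have hτ' {y z : ZMod 11} (hy : y ≠ 0) (hz : z ≠ 0) (h : τ y = τ z) : y = z ∨ y = -z := by
      have h1 := hτ y hy
      rw [h] at h1
      rcases h1 with h1 | h1 <;> rcases hτ z hz with h2 | h2
      · left; linear_combination h1 - h2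
      · right; linear_combination h1 + h2
      · right; linear_combination h1 + h2
      · left; linear_combination h1 - h2
    have hinj : Function.Injective fun i => τ (c i) := by
      intro i j hij
      by_contra hn
      exact (hτ' (h0 i) (h0 j) hij).elim (hne i j hn).1 (hne i j hn).2
    obtain ⟨i, hi⟩ := Finite.surjective_of_injective hinj (τ z)
    exact ⟨i, hτ' hz (h0 i) hi.symm⟩
  -- Each doubling of a coefficient is, up to sign, another coefficient, and the resulting relation
  -- carries the ratio along.
  have hpow (n : ℕ) : ∃ i, c' i = c' 0 / c 0 * c i ∧ (c i = 2 ^ n * c 0 ∨ c i = -(2 ^ n * c 0)) := by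
    induction n with
    | zero => exact ⟨0, (div_mul_cancel₀ _ (h0 0)).symm, by simp⟩
    | succ n ih =>
      obtain ⟨i, hi, hn⟩ := ih
      obtain ⟨j, hj⟩ := hcls (2 * c i) (mul_ne_zero (by decide) (h0 i))
      have hij : i ≠ j := by
        rintro rfl
        rcases hj with hj | hj
        · exact h0 i (by linear_combination hj)
        · have : 3 * c i = 0 := by linear_combination hj
          exact h0 i ((mul_eq_zero.1 this).resolve_left (by decide))
      refine ⟨j, ?_, ?_⟩
      · rcases hj with hj | hj
        · have := h i j hij (-1) (by simp; linear_combination hj)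
          simp at this
          linear_combination -this + 2 * hi + c' 0 / c 0 * hj
        · have := h i j hij 1 (by simp; linear_combination hj)
          simp at this
          linear_combination this - 2 * hi - c' 0 / c 0 * hj
      · rcases hj with hj | hj <;> rcases hn with hn | hn
        · left; linear_combination -hj + 2 * hn
        · right; linear_combination -hj + 2 * hn
        · right; linear_combination hj - 2 * hn
        · left; linear_combination hj - 2 * hn
  intro i
  -- `2` is a primitive root modulo `11` and `2 ^ 5 = -1`, so five exponents suffice up to sign.
  have hgen : ∀ y z : ZMod 11, y ≠ 0 → z ≠ 0 → ∃ n : Fin 5,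
      y = 2 ^ (n : ℕ) * z ∨ y = -(2 ^ (n : ℕ) * z) := by decide
  obtain ⟨n, hn⟩ := hgen (c i) (c 0) (h0 i) (h0 0)
  obtain ⟨j, hj, hjn⟩ := hpow n
  obtain rfl : i = j := by
    by_contra hij
    have := hne i j hij
    rcases hn with hn | hn <;> rcases hjn with hjn | hjn <;> rw [hn, hjn] at this <;> simp at this
  exact hj

end CrossTiling

theorem mainTheorem7 :
    (∀ T : Set (CrossTiling.Word 5), CrossTiling.IsZTiling T → ∀ W ∈ T,
      CrossTiling.Congruent
        (CrossTiling.relativeTo (CrossTiling.neighborhood T 5 W) W)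
        CrossTiling.canonicalNeighborhood) ∧
    (∀ T T' : Set (CrossTiling.Word 5), CrossTiling.IsZTiling T → CrossTiling.IsZTiling T' →
      ∀ W ∈ T, ∀ W' ∈ T',
        CrossTiling.relativeTo (CrossTiling.codewordsOfType T {2, 1} W) W =
          CrossTiling.relativeTo (CrossTiling.codewordsOfType T' {2, 1} W') W' →
        CrossTiling.relativeTo (CrossTiling.neighborhood T 5 W) W =
          CrossTiling.relativeTo (CrossTiling.neighborhood T' 5 W') W') := by
  refine ⟨fun T hT W hW => ?_, fun T T' hT hT' W hW W' hW' hB => ?_⟩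
  · obtain ⟨c, h0, hne, hc⟩ := hT.exists_mem_iff hW
    refine CrossTiling.congruent_canonicalNeighborhood h0 hne fun v => ?_
    rw [CrossTiling.mem_relativeTo_neighborhood, hc]
    tauto
  · obtain ⟨c, h0, hne, hc⟩ := hT.exists_mem_iff hW
    obtain ⟨c', h0', -, hc'⟩ := hT'.exists_mem_iff hW'
    obtain ⟨r, hr, h⟩ := CrossTiling.exists_eq_mul_of_relations h0 h0' hne fun i j hij ε h => by
      have hv := CrossTiling.hasType_two_one i j hij ε
      have key (c : Fin 5 → ZMod 11) : ∑ l, c l *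
          ((Pi.single i 2 + Pi.single j (ε : ℤ) : CrossTiling.Word 5) l : ZMod 11) =
          c i * 2 + c j * (ε : ℤ) := by
        simp [Pi.single_apply, mul_add, Finset.sum_add_distrib,
          apply_ite (Int.cast (R := ZMod 11))]
      rw [← key, ← hc']
      rw [← key, ← hc] at h
      exact (CrossTiling.mem_relativeTo_codewordsOfType.1
        (hB ▸ CrossTiling.mem_relativeTo_codewordsOfType.2 ⟨h, hv⟩)).1
    ext v
    rw [CrossTiling.mem_relativeTo_neighborhood, CrossTiling.mem_relativeTo_neighborhood, hc, hc']
    simp only [h, mul_assoc, ← Finset.mul_sum, mul_eq_zero, hr, false_or]
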